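/- Let $L$ be a first-order language and let $M$ be a nonempty $L$-structure (for instance a monster model $\mathfrak C$ of a complete theory $T$). Let $x,y$ be finite tuples of variables, let $\varphi(x;y)$ be an $L$-formula and let $p(x)$ be a set of $L$-formulas. For a set $B$ of $y$-tuples from $M$, let $S_\varphi(B)\cap[p]$ be the set of all maximal subsets of $\{\varphi(x;b):b\in B\}\cup\{\neg\varphi(x;b):b\in B\}$ that are consistent with $p(x)$, that is, whose union with $p(x)$ is finitely satisfiable in $M$. For $\ell\in\mathbb R$, say that $\varphi$ has $\mathrm{VC}_{\mathrm{ind}}$-density $\le\ell$ with respect to $p$ if there is $K\in\mathbb R$ such that, for all $N\ge 1$ and all indiscernible sequences $\langle b_i:i<N\rangle$ of $y$-tuples from $M$ (that is, for every $k$, any two increasing $k$-tuples of members of the sequence satisfy the same $L$-formulas), $$|S_\varphi(\{b_i:i<N\})\cap[p]|\le K\cdot N^{\ell}.$$ The $\mathrm{VC}_{\mathrm{ind}}$-density of $\varphi$ with respect to $p$ is the infimum in $[-\infty,\infty]$ of all such $\ell$ ($+\infty$ if there are none). Then $\mathrm{VC}_{\mathrm{ind}}$-density is integer valued. Precisely: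 1. For every integer $n\ge 0$ and every real $\ell<n+1$, if $\varphi$ has $\mathrm{VC}_{\mathrm{ind}}$-density $\le\ell$ with respect to $p$, then $\varphi$ has $\mathrm{VC}_{\mathrm{ind}}$-density $\le n$ with respect to $p$. 2. If $p$ is a partial type, that is, finitely satisfiable in $M$, then the $\mathrm{VC}_{\mathrm{ind}}$-density of $\varphi$ with respect to $p$ is either $+\infty$ or a non-negative integer. (The case $p=\emptyset$, i.e. $x=x$, is the $\mathrm{VC}_{\mathrm{ind}}$-density of $\varphi$.) -/

import Mathlib

open FirstOrder

namespace VCInd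

universe u v w x y

variable (L : FirstOrder.Language.{u, v}) {M : Type w} [L.Structure M]
variable {α : Type x} {β : Type y}

/-- A sequence `b` of `β`-tuples of `M`, indexed by an ordered set `ι`, is indiscernible (over the
empty set): any two increasing `k`-tuples from it satisfy the same `L`-formulas. -/
def Indiscernible {ι : Type*} [Preorder ι] (b : ι → β → M) : Prop :=
  ∀ (k : ℕ) (θ : L.Formula (Fin k × β)) (f g : Fin k ↪o ι),
    θ.Realize (fun c => b (f c.1) c.2) ↔ θ.Realize (fun c => b (g c.1) c.2)

variable {L}

variable (M) in
/-- A set `p(x)` of `L`-formulas is a partial type of `M`: it is finitely satisfiable in `M`. -/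
def IsPartialType (p : Set (L.Formula α)) : Prop :=
  ∀ p₀ : Set (L.Formula α), p₀ ⊆ p → p₀.Finite → ∃ a : α → M, ∀ ψ ∈ p₀, ψ.Realize a

/-- The set of formulas `{φ(x; b) : b ∈ B} ∪ {¬φ(x; b) : b ∈ B}`. The pair `(b, true)` stands for
the formula `φ(x; b)` and the pair `(b, false)` stands for `¬φ(x; b)`. -/
def instances (B : Set (β → M)) : Set ((β → M) × Bool) :=
  {c | c.1 ∈ B}

/-- `a` satisfies the signed instance `c` of `φ(x; y)`. -/
def Satisfies (φ : L.Formula (α ⊕ β)) (a : α → M) (c : (β → M) × Bool) : Prop :=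
  φ.Realize (Sum.elim a c.1) ↔ c.2 = true

/-- A set `q` of signed instances of `φ(x; y)` is consistent with `p(x)`: the set of formulas
`p ∪ q` over `M` is finitely satisfiable in `M`. -/
def ConsistentWith (p : Set (L.Formula α)) (φ : L.Formula (α ⊕ β))
    (q : Set ((β → M) × Bool)) : Prop :=
  ∀ (p₀ : Set (L.Formula α)) (q₀ : Set ((β → M) × Bool)),
    p₀ ⊆ p → p₀.Finite → q₀ ⊆ q → q₀.Finite →
      ∃ a : α → M, (∀ ψ ∈ p₀, ψ.Realize a) ∧ ∀ c ∈ q₀, Satisfies φ a c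

/-- `S_φ(B) ∩ [p]`, the set of all `φ`-types over `B` consistent with `p`: the maximal subsets of
`{φ(x; b) : b ∈ B} ∪ {¬φ(x; b) : b ∈ B}` consistent with `p`. -/
def phiTypes (p : Set (L.Formula α)) (φ : L.Formula (α ⊕ β)) (B : Set (β → M)) :
    Set (Set ((β → M) × Bool)) :=
  {q | Maximal (fun q' => q' ⊆ instances B ∧ ConsistentWith p φ q') q}

theorem mem_phiTypes {p : Set (L.Formula α)} {φ : L.Formula (α ⊕ β)} {B : Set (β → M)}
    {q : Set ((β → M) × Bool)} :
    q ∈ phiTypes p φ B ↔ Maximal (fun q' => q' ⊆ instances B ∧ ConsistentWith p φ q') q :=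
  Iff.rfl

/-- Over a finite set there are finitely many `φ`-types, so `Set.ncard` counts them correctly. -/
theorem phiTypes_finite (p : Set (L.Formula α)) (φ : L.Formula (α ⊕ β)) {B : Set (β → M)}
    (hB : B.Finite) : (phiTypes p φ B).Finite := by
  have h : (instances B).Finite :=
    (hB.prod (Set.finite_univ (α := Bool))).subset fun c hc => ⟨hc, trivial⟩
  exact h.finite_subsets.subset fun q hq => (mem_phiTypes.1 hq).prop.1

variable (M)

/-- `φ(x; y)` has VC_ind-density `≤ ℓ` with respect to `p(x)` in `M`. The empty sequence, for which
`N ^ ℓ` is not meaningful for all `ℓ`, is left out. -/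
def VCIndDensityLE (p : Set (L.Formula α)) (φ : L.Formula (α ⊕ β)) (ℓ : ℝ) : Prop :=
  ∃ K : ℝ, ∀ N : ℕ, 0 < N → ∀ b : Fin N → β → M, Indiscernible L b →
    ((phiTypes p φ (Set.range b)).ncard : ℝ) ≤ K * (N : ℝ) ^ ℓ

/-- The VC_ind-density of `φ(x; y)` with respect to `p(x)` in `M`: the infimum of all real `ℓ` such
that the VC_ind-density is `≤ ℓ`; it is `⊤` if there is no such `ℓ`. -/
noncomputable def vcIndDensity (p : Set (L.Formula α)) (φ : L.Formula (α ⊕ β)) : EReal :=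
  sInf ((fun ℓ : ℝ => (ℓ : EReal)) '' {ℓ : ℝ | VCIndDensityLE M p φ ℓ})

end VCInd

/-! A `φ`-type over a finite indiscernible sequence is a word of signs. Indiscernibility lets a
consistent word, restricted to any subset of the indices, be moved to any other subset of the same
size (`Indiscernible.comp_mem_patterns`). So the subwords of consistent words form a class closed
under subwords, whose words of length `k` are counted by types over the first `k` terms.

The rest is combinatorics of such classes (`exists_ncard_le_mul_pow`). Write words by their run
lengths. A word with `2k` runs contains all `2 ^ k` words of length `k`, so polynomial growth bounds
the number of runs by a constant. A word with `n + 2` long runs has about `t ^ (n + 1)` subwords of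
length `t`, too many when `ℓ < n + 1`. Hence at most `n + 1` runs are long; as the total length is
`N`, only `n` of them are free, which leaves `O(N ^ n)` words. All constants depend only on `K`,
`ℓ`, `n`, so one bound serves all sequences. -/

namespace VCInd

/-! ### Words and their run lengths -/

/-- The word consisting of consecutive runs of alternating letters, starting with the letter `c`,
with the given run lengths. -/
def runs : Bool → List ℕ → List Bool
  | _, [] => []
  | c, a :: l => List.replicate a c ++ runs (!c) l

theorem length_runs (c : Bool) (l : List ℕ) : (runs c l).length = l.sum := by
  induction l generalizing c with
  | nil => rfl
  | cons a l ih => simp [runs, ih]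

theorem exists_runs_eq (w : List Bool) : ∃ c l, (∀ a ∈ l, 0 < a) ∧ runs c l = w := by
  induction w with
  | nil => exact ⟨true, [], by simp, rfl⟩
  | cons d w ih =>
    obtain ⟨c, l, hl, rfl⟩ := ih
    cases l with
    | nil => exact ⟨d, [1], by simp, rfl⟩
    | cons a l =>
      by_cases h : c = d
      · subst h
        exact ⟨c, (a + 1) :: l, by simp_all, by simp [runs, List.replicate_succ]⟩
      · have h' : d = !c := by cases c <;> cases d <;> simp_all
        subst h'
        exact ⟨!c, 1 :: a :: l, by simp_all, by simp [runs]⟩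

/-- Two consecutive nonempty runs contain both letters, so each letter of `v` uses up at most two
runs. -/
theorem sublist_runs (v : List Bool) (c : Bool) (l : List ℕ) (hl : ∀ a ∈ l, 0 < a)
    (h : 2 * v.length ≤ l.length) : v.Sublist (runs c l) := by
  induction v generalizing l with
  | nil => simp
  | cons d v ih =>
    match l, hl, h with
    | a :: b :: l, hl, h =>
      have ih' := ih l (fun x hx => hl x (by simp [hx])) (by simp at h; omega)
      have hd : [d].Sublist (List.replicate a c ++ List.replicate b (!c)) := by
        have ha := hl a (by simp)
        have hb := hl b (by simp)
        rw [List.singleton_sublist]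
        cases c <;> cases d <;> simp <;> omega
      simpa [runs] using hd.append ih'

theorem runs_sublist_runs (c : Bool) {l l' : List ℕ} (h : List.Forall₂ (· ≤ ·) l l') :
    (runs c l).Sublist (runs c l') := by
  induction h generalizing c with
  | nil => simp
  | cons h _ ih => exact ((List.replicate_sublist_replicate _).2 h).append (ih _)

theorem head_runs {c d : Bool} {l : List ℕ} {w : List Bool} (hl : ∀ a ∈ l, 0 < a)
    (h : runs c l = d :: w) : d = c := by
  cases l with
  | nil => simp [runs] at h
  | cons a l =>
    obtain ⟨a, rfl⟩ := Nat.exists_eq_succ_of_ne_zero (hl a (by simp)).ne'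
    simp only [runs, Nat.succ_eq_add_one, List.replicate_succ, List.cons_append,
      List.cons.injEq] at h
    exact h.1.symm

theorem le_of_runs_eq {c : Bool} {a a' : ℕ} {l : List ℕ} {w : List Bool}
    (hl : ∀ x ∈ l, 0 < x)
    (h : List.replicate a c ++ runs (!c) l = List.replicate a' c ++ w) : a' ≤ a := by
  by_contra! hlt
  obtain ⟨d, rfl⟩ := Nat.exists_eq_add_of_lt hlt
  rw [show a + d + 1 = a + (d + 1) by ring, List.replicate_add, List.append_assoc,
    List.append_cancel_left_eq, List.replicate_succ, List.cons_append] at h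
  exact absurd (head_runs hl h) (by simp)

theorem runs_injOn (c : Bool) {l l' : List ℕ} (hl : ∀ a ∈ l, 0 < a) (hl' : ∀ a ∈ l', 0 < a)
    (h : runs c l = runs c l') : l = l' := by
  induction l generalizing c l' with
  | nil =>
    cases l' with
    | nil => rfl
    | cons a l' =>
      have h1 := congrArg List.length h
      have := hl' a (by simp)
      simp [length_runs] at h1
      omega
  | cons a l ih =>
    cases l' with
    | nil =>
      have h1 := congrArg List.length h
      have := hl a (by simp)
      simp [length_runs] at h1
      omega
    | cons a' l' =>
      have h1 : ∀ x ∈ l, 0 < x := fun x hx => hl x (by simp [hx])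
      have h2 : ∀ x ∈ l', 0 < x := fun x hx => hl' x (by simp [hx])
      have e : a = a' := le_antisymm (le_of_runs_eq h2 h.symm) (le_of_runs_eq h1 h)
      subst e
      rw [ih (!c) h1 h2 (List.append_cancel_left h)]

/-! ### Counting words by their long runs -/

open Finset in
/-- A word with `m + 1` long runs has many subwords of a given length. -/
theorem pow_le_ncard_sublist_runs (c : Bool) {R s t m : ℕ} (hs : 0 < s) (ht : R * s ≤ t)
    (r : Fin R → ℕ) (hr : ∀ i, 0 < r i)
    (hm : m + 1 ≤ #{i | t ≤ r i}) :
    s ^ m ≤ {v : List Bool | v.Sublist (runs c (List.ofFn r)) ∧ v.length = t}.ncard := by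
  classical
  obtain ⟨i₀, hi₀⟩ : ({i | t ≤ r i} : Finset (Fin R)).Nonempty := card_pos.1 (by omega)
  have hi₀' : t ≤ r i₀ := by simpa using hi₀
  obtain ⟨T, hT, hTm⟩ := exists_subset_card_eq
    (s := ({i | t ≤ r i} : Finset (Fin R)).erase i₀) (n := m)
    (by rw [card_erase_of_mem hi₀]; omega)
  -- The `m` runs in `T` get free lengths in `[1, s]`. The reserved long run `i₀ ∉ T` will absorb
  -- whatever is missing from the total `t`; `R * s ≤ t` leaves it at least one letter.
  let G : Finset (Fin R → ℕ) := Fintype.piFinset fun i => if i ∈ T then Icc 1 s else {1}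
  have hG : #G = s ^ m := by
    have : ∀ i, #(if i ∈ T then Icc 1 s else {1}) = if i ∈ T then s else 1 := by
      intro i; split_ifs <;> simp
    simp [G, Fintype.card_piFinset, this, prod_ite_mem, hTm]
  have hmem : ∀ g ∈ G, ∀ i, 1 ≤ g i ∧ g i ≤ s ∧ (i ∉ T → g i = 1) := by
    intro g hg i
    have := Fintype.mem_piFinset.1 hg i
    split_ifs at this with h
    · simp at this; exact ⟨this.1, this.2, fun h' => absurd h h'⟩
    · simp at this; omega
  let F : (Fin R → ℕ) → Fin R → ℕ := fun g =>
    Function.update g i₀ (t - ∑ i ∈ univ.erase i₀, g i)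
  have hsum : ∀ g ∈ G, ∑ i ∈ univ.erase i₀, g i + s ≤ t := by
    intro g hg
    have h1 : ∑ i ∈ univ.erase i₀, g i ≤ #(univ.erase i₀) • s :=
      sum_le_card_nsmul _ _ _ fun i _ => (hmem g hg i).2.1
    rw [card_erase_of_mem (mem_univ _), card_univ, Fintype.card_fin, smul_eq_mul] at h1
    have hR : 0 < R := i₀.pos
    obtain ⟨R', rfl⟩ := Nat.exists_eq_succ_of_ne_zero hR.ne'
    simp only [Nat.succ_eq_add_one, Nat.add_sub_cancel] at h1
    nlinarith
  have hpos : ∀ g ∈ G, ∀ i, 0 < F g i := by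
    intro g hg i
    by_cases h : i = i₀
    · subst h
      have := hsum g hg
      simp only [F, Function.update_self]; omega
    · simpa [F, Function.update_of_ne h] using Nat.pos_of_ne_zero (Nat.one_le_iff_ne_zero.1 (hmem g hg i).1)
  have hle : ∀ g ∈ G, ∀ i, F g i ≤ r i := by
    intro g hg i
    by_cases h : i = i₀
    · subst h
      simp only [F, Function.update_self]; omega
    · simp only [F, Function.update_of_ne h]
      by_cases hi : i ∈ T
      · have h1 : t ≤ r i := by simpa using mem_of_mem_erase (hT hi)
        have := hsum g hg
        have := (hmem g hg i).2.1
        omega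
      · rw [(hmem g hg i).2.2 hi]; exact hr i
  have hposl : ∀ g ∈ G, ∀ a ∈ List.ofFn (F g), 0 < a := by
    intro g hg a ha
    obtain ⟨i, rfl⟩ := List.mem_ofFn.1 ha
    exact hpos g hg i
  rw [← hG, ← Set.ncard_coe_finset]
  refine Set.ncard_le_ncard_of_injOn (fun g => runs c (List.ofFn (F g))) ?_ ?_ ?_
  · intro g hg
    refine ⟨runs_sublist_runs c ?_, ?_⟩
    · rw [List.forall₂_iff_get]
      refine ⟨by simp, fun i h₁ h₂ => ?_⟩
      simpa using hle g hg _
    · have := hsum g hg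
      rw [length_runs, List.sum_ofFn, ← add_sum_erase _ _ (mem_univ i₀)]
      have : ∑ i ∈ univ.erase i₀, F g i = ∑ i ∈ univ.erase i₀, g i :=
        sum_congr rfl fun i hi => by simp [F, Function.update_of_ne (ne_of_mem_erase hi)]
      rw [this]
      simp only [F, Function.update_self]
      omega
  -- `F` overwrites only coordinate `i₀`, where every `g ∈ G` equals `1`.
  · intro g hg g' hg' h
    have h1 := List.ofFn_injective (runs_injOn c (hposl g hg) (hposl g' hg') h)
    funext i
    by_cases hi : i = i₀
    · subst hi
      have hi : i ∉ T := fun h => notMem_erase i _ (hT h)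
      rw [(hmem g hg i).2.2 hi, (hmem g' hg' i).2.2 hi]
    · simpa [F, Function.update_of_ne hi] using congrFun h1 i
  · exact (List.finite_length_eq Bool t).subset fun v hv => hv.2

-- Fix the set of long coordinates, in at most `2 ^ R` ways. Short coordinates take fewer than `t`
-- values, and one long coordinate is recovered from the sum, so at most `n` range over `N + 1`
-- values.
open Finset in
theorem card_few_long {R t n N : ℕ} (ht : 0 < t) :
    {r : Fin R → ℕ | ∑ i, r i = N ∧ #{i | t ≤ r i} ≤ n + 1}.Finite ∧
    {r : Fin R → ℕ | ∑ i, r i = N ∧ #{i | t ≤ r i} ≤ n + 1}.ncard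
      ≤ 2 ^ R * (t ^ R * (N + 1) ^ n) := by
  classical
  let B : Finset (Fin R → ℕ) := {r ∈ Fintype.piFinset fun _ => range (N + 1) |
    ∑ i, r i = N ∧ #{i | t ≤ r i} ≤ n + 1}
  have hB : {r : Fin R → ℕ | ∑ i, r i = N ∧ #{i | t ≤ r i} ≤ n + 1} = B := by
    ext r
    simp only [Set.mem_ofPred_eq, coe_filter, Fintype.mem_piFinset, mem_range, B]
    refine ⟨fun h => ⟨fun i => ?_, h⟩, fun h => h.2⟩
    have := single_le_sum (f := r) (fun _ _ => Nat.zero_le _) (mem_univ i)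
    omega
  rw [hB, Set.ncard_coe_finset]
  refine ⟨finite_toSet _, ?_⟩
  have key : ∀ S ∈ (univ : Finset (Finset (Fin R))),
      #{r ∈ B | ({i | t ≤ r i} : Finset (Fin R)) = S} ≤ t ^ R * (N + 1) ^ n := by
    intro S _
    by_cases hS : #S ≤ n + 1
    swap
    · rw [filter_eq_empty_iff.2]
      · simp
      · rintro r hr rfl
        exact hS (mem_filter.1 hr).2.2
    have hcard : ∀ A : Finset (Fin R), #A ≤ n →
        #(Fintype.piFinset fun i => if i ∈ A then range (N + 1) else range t)
          ≤ t ^ R * (N + 1) ^ n := by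
      intro A hA
      have h1 : ∀ i, #(if i ∈ A then range (N + 1) else range t)
          ≤ t * if i ∈ A then N + 1 else 1 := by
        intro i
        split_ifs
        · simp only [card_range]; nlinarith
        · simp
      calc _ ≤ ∏ i : Fin R, (t * if i ∈ A then N + 1 else 1) := by
            rw [Fintype.card_piFinset]; exact prod_le_prod' fun i _ => h1 i
        _ = t ^ R * (N + 1) ^ #A := by
            rw [prod_mul_distrib]; simp [prod_ite_mem]
        _ ≤ _ := by gcongr; omega
    rcases S.eq_empty_or_nonempty with rfl | ⟨i₀, hi₀⟩
    · refine (card_le_card ?_).trans (hcard ∅ (by simp))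
      intro r hr
      have := (mem_filter.1 hr).2
      simpa [Fintype.mem_piFinset, filter_eq_empty_iff] using this
    -- Overwriting the redundant long coordinate by `0 < t` makes it count as a short one.
    · refine (card_le_card_of_injOn (fun r => Function.update r i₀ 0) ?_ ?_).trans
        (hcard (S.erase i₀) (by rw [card_erase_of_mem hi₀]; omega))
      · intro r hr
        obtain ⟨hr1, hr2⟩ := mem_filter.1 hr
        have hr3 := (mem_filter.1 hr1).1
        refine Fintype.mem_piFinset.2 fun i => ?_
        by_cases hi : i = i₀
        · subst hi; simpa using ht
        · by_cases hiS : i ∈ S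
          · simpa [hi, hiS] using Fintype.mem_piFinset.1 hr3 i
          · have : ¬ t ≤ r i := by rw [← hr2] at hiS; simpa using hiS
            simpa [hi, hiS] using this
      · intro r hr r' hr' h
        have e : ∀ i ≠ i₀, r i = r' i := fun i hi => by
          simpa [Function.update_of_ne hi] using congrFun h i
        have s1 := (mem_filter.1 (mem_filter.1 hr).1).2.1
        have s2 := (mem_filter.1 (mem_filter.1 hr').1).2.1
        rw [← add_sum_erase _ _ (mem_univ i₀)] at s1 s2
        have s3 : ∑ i ∈ univ.erase i₀, r i = ∑ i ∈ univ.erase i₀, r' i :=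
          sum_congr rfl fun i hi => e i (ne_of_mem_erase hi)
        funext i
        by_cases hi : i = i₀
        · subst hi; omega
        · exact e i hi
  calc #B ≤ t ^ R * (N + 1) ^ n * #(univ : Finset (Finset (Fin R))) :=
        card_le_mul_card_image_of_maps_to (fun _ _ => mem_univ _) _ key
    _ = _ := by simp [mul_comm]

/-! ### Constants, and growth of subword-closed classes -/

theorem exists_mul_rpow_lt_two_pow (K ℓ : ℝ) : ∃ k : ℕ, 0 < k ∧ K * (k : ℝ) ^ ℓ < 2 ^ k := by
  have h : (fun k : ℕ => K * (k : ℝ) ^ ℓ) =o[Filter.atTop] fun k : ℕ => (2 : ℝ) ^ k := by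
    refine ((isLittleO_rpow_exp_pos_mul_atTop ℓ (Real.log_pos one_lt_two)).comp_tendsto
      tendsto_natCast_atTop_atTop).const_mul_left K |>.congr_right fun k => ?_
    simp [mul_comm (Real.log 2), Real.exp_nat_mul, Real.exp_log]
  obtain ⟨k, hk, h0⟩ := ((h.bound (c := 1 / 2) (by norm_num)).and
    (Filter.eventually_gt_atTop 0)).exists
  refine ⟨k, h0, ?_⟩
  have h2 : (0 : ℝ) < 2 ^ k := by positivity
  rw [Real.norm_eq_abs, Real.norm_eq_abs, abs_of_pos h2] at hk
  linarith [le_abs_self (K * (k : ℝ) ^ ℓ)]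

theorem exists_mul_rpow_lt_pow (K ℓ : ℝ) (R m : ℕ) (h : ℓ < m) :
    ∃ s : ℕ, 0 < s ∧ K * ((R * s : ℕ) : ℝ) ^ ℓ < (s : ℝ) ^ m := by
  have h1 : Filter.Tendsto (fun s : ℕ => K * (R : ℝ) ^ ℓ * (s : ℝ) ^ (ℓ - m)) Filter.atTop
      (nhds (K * (R : ℝ) ^ ℓ * 0)) := by
    have := (tendsto_rpow_neg_atTop (sub_pos.2 h)).comp tendsto_natCast_atTop_atTop
    simp only [neg_sub] at this
    exact this.const_mul _
  rw [mul_zero] at h1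
  obtain ⟨s, hs, h0⟩ := ((h1.eventually_lt_const one_pos).and
    (Filter.eventually_gt_atTop 0)).exists
  refine ⟨s, h0, ?_⟩
  have h2 : (0 : ℝ) < s := by exact_mod_cast h0
  rw [Real.rpow_sub h2, Real.rpow_natCast, ← mul_div_assoc, div_lt_one (by positivity)] at hs
  rwa [Nat.cast_mul, Real.mul_rpow (by positivity) (by positivity), ← mul_assoc]

/-- The growth of a family of words closed under taking subwords is, uniformly in the family,
polynomial of integer degree. -/
theorem exists_ncard_le_mul_pow (K ℓ : ℝ) (n : ℕ) (hℓ : ℓ < (n : ℝ) + 1) :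
    ∃ K' : ℝ, ∀ P : Set (List Bool), (∀ v w, v.Sublist w → w ∈ P → v ∈ P) →
      (∀ k : ℕ, 0 < k → ({w ∈ P | w.length = k}.ncard : ℝ) ≤ K * (k : ℝ) ^ ℓ) →
      ∀ N : ℕ, 0 < N → ({w ∈ P | w.length = N}.ncard : ℝ) ≤ K' * (N : ℝ) ^ n := by
  classical
  obtain ⟨k, hk0, hk⟩ := exists_mul_rpow_lt_two_pow K ℓ
  set R := 2 * k with hR
  obtain ⟨s, hs0, hs⟩ := exists_mul_rpow_lt_pow K ℓ R (n + 1) (by exact_mod_cast hℓ)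
  set t := R * s with ht
  have ht0 : 0 < t := by positivity
  -- The factors `2` and `R` count first letters and numbers of runs; `2 ^ n` comes from `N + 1 ≤ 2
  -- * N`.
  refine ⟨((2 * R * (2 ^ R * (t ^ R * 2 ^ n)) : ℕ) : ℝ), fun P hP hcount N hN => ?_⟩
  have hfin : ∀ k, {w ∈ P | w.length = k}.Finite := fun k =>
    (List.finite_length_eq Bool k).subset fun w hw => hw.2
  have hshort : ∀ c l, (∀ a ∈ l, 0 < a) → runs c l ∈ P → l.length < R := by
    intro c l hl hw
    by_contra! hlen
    have h1 : (2 : ℕ) ^ k ≤ {w ∈ P | w.length = k}.ncard := by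
      have h2 : (Set.univ : Set (Fin k → Bool)).ncard = 2 ^ k := by
        simp [Set.ncard_univ]
      rw [← h2]
      refine Set.ncard_le_ncard_of_injOn List.ofFn (fun v _ => ⟨hP _ _ ?_ hw, List.length_ofFn⟩)
        List.ofFn_injective.injOn (hfin k)
      exact sublist_runs _ c l hl (by simpa [hR] using hlen)
    have h2 := hcount k hk0
    have h3 : (2 : ℝ) ^ k ≤ ({w ∈ P | w.length = k}.ncard : ℝ) := by exact_mod_cast h1
    linarith
  have hlong : ∀ c (m : ℕ) (r : Fin m → ℕ), m < R → (∀ i, 0 < r i) →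
      runs c (List.ofFn r) ∈ P → Finset.card {i | t ≤ r i} ≤ n + 1 := by
    intro c m r hm hr hw
    by_contra! hlen
    have h1 := pow_le_ncard_sublist_runs c hs0 (by rw [ht]; gcongr : m * s ≤ t) r hr hlen
    have h2 : s ^ (n + 1) ≤ {w ∈ P | w.length = t}.ncard :=
      h1.trans (Set.ncard_le_ncard (fun v hv => ⟨hP _ _ hv.1 hw, hv.2⟩) (hfin t))
    have h3 := hcount t ht0
    have h4 : (s : ℝ) ^ (n + 1) ≤ ({w ∈ P | w.length = t}.ncard : ℝ) := by exact_mod_cast h2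
    linarith
  let A : (m : ℕ) → Set (Fin m → ℕ) := fun m =>
    {r : Fin m → ℕ | ∑ i, r i = N ∧ Finset.card {i | t ≤ r i} ≤ n + 1}
  let B : Bool × Fin R → Set (List Bool) := fun q =>
    (fun r => runs q.1 (List.ofFn r)) '' A q.2
  have hB : ∀ q, (B q).ncard ≤ 2 ^ R * (t ^ R * (N + 1) ^ n) := by
    intro q
    obtain ⟨hf, hc⟩ := card_few_long (R := q.2) (n := n) (N := N) ht0
    refine (Set.ncard_image_le hf).trans (hc.trans ?_)
    gcongr
    · norm_num
    · exact q.2.2.le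
    · exact q.2.2.le
  have hsub : {w ∈ P | w.length = N} ⊆ ⋃ q, B q := by
    rintro w ⟨hw, hwN⟩
    obtain ⟨c, l, hl, rfl⟩ := exists_runs_eq w
    have hm := hshort c l hl hw
    refine Set.mem_iUnion.2 ⟨(c, ⟨l.length, hm⟩), l.get, ⟨?_, ?_⟩, ?_⟩
    · rw [← List.sum_ofFn, List.ofFn_get, ← hwN, length_runs]
    · exact hlong c l.length l.get hm (fun i => hl _ (List.get_mem _ _))
        (by rwa [List.ofFn_get])
    · simp only [List.ofFn_get]
  have hBf : ∀ q, (B q).Finite := fun q => (card_few_long ht0).1.image _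
  have main : {w ∈ P | w.length = N}.ncard ≤ 2 * R * (2 ^ R * (t ^ R * 2 ^ n)) * N ^ n := by
    calc _ ≤ (⋃ q, B q).ncard := Set.ncard_le_ncard hsub (Set.finite_iUnion hBf)
      _ ≤ ∑ q, (B q).ncard := by
          simpa using Finset.set_ncard_biUnion_le Finset.univ B
      _ ≤ ∑ _q : Bool × Fin R, 2 ^ R * (t ^ R * (N + 1) ^ n) := Finset.sum_le_sum fun q _ => hB q
      _ = 2 * R * (2 ^ R * (t ^ R * (N + 1) ^ n)) := by simp
      _ ≤ 2 * R * (2 ^ R * (t ^ R * (2 * N) ^ n)) := by gcongr; omega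
      _ = _ := by rw [mul_pow]; ring
  exact_mod_cast main

-- Types over indiscernible sequences as sign patterns

universe u v w x y
variable {L : FirstOrder.Language.{u, v}} {M : Type w} [L.Structure M]
variable {α : Type x} {β : Type y}

/-- The set of sign patterns `h` such that `φ(x; b i)` with sign `h i`, for all `i`, is
consistent with `p`. -/
def patterns (p : Set (L.Formula α)) (φ : L.Formula (α ⊕ β)) {N : ℕ} (b : Fin N → β → M) :
    Set (Fin N → Bool) :=
  {h | ConsistentWith p φ (Set.range fun i => (b i, h i))}

variable {p : Set (L.Formula α)} {φ : L.Formula (α ⊕ β)}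

theorem ConsistentWith.mono {q q' : Set ((β → M) × Bool)} (h : ConsistentWith p φ q)
    (hq : q' ⊆ q) : ConsistentWith p φ q' :=
  fun p₀ q₀ hp hpf hq₀ => h p₀ q₀ hp hpf (hq₀.trans hq)

theorem ConsistentWith.eq_of_mem {q : Set ((β → M) × Bool)} (h : ConsistentWith p φ q)
    {c : β → M} {s t : Bool} (hs : (c, s) ∈ q) (ht : (c, t) ∈ q) : s = t := by
  obtain ⟨a, -, ha⟩ := h ∅ {(c, s), (c, t)} (Set.empty_subset _) Set.finite_empty
    (Set.pair_subset hs ht) (Set.toFinite _)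
  have h1 : Satisfies φ a (c, s) := ha _ (by simp)
  have h2 : Satisfies φ a (c, t) := ha _ (by simp)
  simp only [Satisfies] at h1 h2
  exact Bool.eq_iff_iff.2 (h1.symm.trans h2)

/-- If both signs failed, the two finite witnesses would combine: a realization of their parts in
`p` and `q` gives `φ(x; c)` some truth value, contradicting the witness for that sign. -/
theorem ConsistentWith.exists_insert {q : Set ((β → M) × Bool)} (h : ConsistentWith p φ q)
    (c : β → M) : ∃ s, ConsistentWith p φ (insert (c, s) q) := by
  by_contra! hcon
  have key : ∀ s, ∃ (p₀ : Set (L.Formula α)) (q₀ : Set ((β → M) × Bool)),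
      p₀ ⊆ p ∧ p₀.Finite ∧ q₀ ⊆ insert (c, s) q ∧ q₀.Finite ∧
        ∀ a : α → M, (∀ ψ ∈ p₀, ψ.Realize a) → ∃ d ∈ q₀, ¬ Satisfies φ a d := by
    intro s
    have := hcon s
    simp only [ConsistentWith] at this
    push Not at this
    exact this
  choose p₀ q₀ h1 h2 h3 h4 h5 using key
  obtain ⟨a, ha, ha'⟩ := h (⋃ s, p₀ s) ((⋃ s, q₀ s) ∩ q) (Set.iUnion_subset h1)
    (Set.finite_iUnion h2) Set.inter_subset_right
    ((Set.finite_iUnion h4).subset Set.inter_subset_left)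
  obtain ⟨s, hs⟩ : ∃ s, Satisfies φ a (c, s) := by
    by_cases hφ : φ.Realize (Sum.elim a c)
    · exact ⟨true, by simp [Satisfies, hφ]⟩
    · exact ⟨false, by simp [Satisfies, hφ]⟩
  obtain ⟨d, hd, hd'⟩ := h5 s a fun ψ hψ => ha ψ (Set.mem_iUnion.2 ⟨s, hψ⟩)
  rcases h3 s hd with rfl | hdq
  · exact hd' hs
  · exact hd' (ha' d ⟨Set.mem_iUnion.2 ⟨s, hd⟩, hdq⟩)

/-- By `exists_insert` a maximal set decides every `b i`, and by `eq_of_mem` in only one way.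
Repeated terms do no harm: consistency forces equal signs on them. -/
theorem bijOn_patterns_phiTypes {N : ℕ} (b : Fin N → β → M) :
    Set.BijOn (fun h : Fin N → Bool => Set.range fun i => (b i, h i)) (patterns p φ b)
      (phiTypes p φ (Set.range b)) := by
  have complete : ∀ (h : Fin N → Bool) (q : Set ((β → M) × Bool)),
      q ⊆ instances (Set.range b) → ConsistentWith p φ q →
      Set.range (fun i => (b i, h i)) ⊆ q → q ⊆ Set.range fun i => (b i, h i) := by
    rintro h q hq hc hs ⟨d, s⟩ hd
    obtain ⟨i, rfl⟩ := hq hd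
    exact ⟨i, Prod.ext rfl (hc.eq_of_mem (hs ⟨i, rfl⟩) hd)⟩
  refine ⟨fun h hh => ⟨⟨?_, hh⟩, fun q hq hle => complete h q hq.1 hq.2 hle⟩, ?_, ?_⟩
  · rintro _ ⟨i, rfl⟩
    exact ⟨i, rfl⟩
  · intro h hh h' _ e
    funext i
    refine hh.eq_of_mem (c := b i) ⟨i, rfl⟩ ?_
    have e' : (Set.range fun i => (b i, h i)) = Set.range fun i => (b i, h' i) := e
    rw [e']
    exact ⟨i, rfl⟩
  · intro q hq
    rw [mem_phiTypes] at hq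
    have hex : ∀ i, ∃ s, (b i, s) ∈ q := by
      intro i
      obtain ⟨s, hs⟩ := hq.prop.2.exists_insert (b i)
      refine ⟨s, hq.le_of_ge ⟨?_, hs⟩ (Set.subset_insert _ _) (Set.mem_insert _ _)⟩
      exact Set.insert_subset ⟨i, rfl⟩ hq.prop.1
    choose h hh using hex
    have hsub : Set.range (fun i => (b i, h i)) ⊆ q := by
      rintro _ ⟨i, rfl⟩
      exact hh i
    exact ⟨h, hq.prop.2.mono hsub, hsub.antisymm (complete h q hq.prop.1 hq.prop.2 hsub)⟩

theorem ncard_patterns {N : ℕ} (b : Fin N → β → M) :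
    (patterns p φ b).ncard = (phiTypes p φ (Set.range b)).ncard := by
  have h := bijOn_patterns_phiTypes (p := p) (φ := φ) b
  rw [← h.image_eq, h.injOn.ncard_image]

theorem Indiscernible.comp {ι κ : Type*} [Preorder ι] [Preorder κ] {b : ι → β → M}
    (hb : Indiscernible L b) (e : κ ↪o ι) : Indiscernible L (b ∘ e) :=
  fun k θ f g => hb k θ (f.trans e) (g.trans e)

/-- For a fixed finite part of `p`, realizability of a sign pattern is a single formula about the
parameters, with `x` quantified out; indiscernibility transfers it from `b ∘ f` to `b ∘ g`. -/
theorem Indiscernible.comp_mem_patterns [Finite α] {N k : ℕ} {b : Fin N → β → M}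
    (hb : Indiscernible L b) {h : Fin N → Bool} (hh : h ∈ patterns p φ b)
    (f g : Fin k ↪o Fin N) : h ∘ f ∈ patterns p φ (b ∘ g) := by
  intro p₀ q₀ hp hpf hq hqf
  have := hpf.to_subtype
  let ψ : L.Formula ((Fin k × β) ⊕ α) :=
    (FirstOrder.Language.Formula.iInf fun χ : p₀ => χ.1.relabel Sum.inr) ⊓
    FirstOrder.Language.Formula.iInf fun j : Fin k =>
      let χ : L.Formula ((Fin k × β) ⊕ α) :=
        φ.relabel (Sum.elim Sum.inr fun d => Sum.inl (j, d))
      if h (f j) then χ else χ.not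
  have key : ∀ e : Fin k → β → M, (ψ.iExs α).Realize (fun c => e c.1 c.2) ↔
      ∃ a : α → M, (∀ χ ∈ p₀, χ.Realize a) ∧ ∀ j, Satisfies φ a (e j, h (f j)) := by
    intro e
    rw [FirstOrder.Language.Formula.realize_iExs]
    refine exists_congr fun a => ?_
    rw [FirstOrder.Language.Formula.realize_inf, FirstOrder.Language.Formula.realize_iInf,
      FirstOrder.Language.Formula.realize_iInf, Subtype.forall]
    refine and_congr ?_ (forall_congr' fun j => ?_)
    · simp [FirstOrder.Language.Formula.realize_relabel, Function.comp_def]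
    · have e1 : (Sum.elim (fun c : Fin k × β => e c.1 c.2) a ∘
          Sum.elim Sum.inr fun d => Sum.inl (j, d)) = Sum.elim a (e j) := by
        funext z; cases z <;> rfl
      cases h (f j) <;>
        simp [Satisfies, FirstOrder.Language.Formula.realize_relabel, e1,
          FirstOrder.Language.Formula.realize_not]
  have h1 := (key fun j => b (f j)).2 <| by
    obtain ⟨a, ha, ha'⟩ := hh p₀ (Set.range fun j => (b (f j), h (f j))) hp hpf
      (by rintro _ ⟨j, rfl⟩; exact ⟨f j, rfl⟩) (Set.finite_range _)
    exact ⟨a, ha, fun j => ha' _ ⟨j, rfl⟩⟩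
  obtain ⟨a, ha, ha'⟩ := (key fun j => b (g j)).1 ((hb k (ψ.iExs α) f g).1 h1)
  refine ⟨a, ha, fun c hc => ?_⟩
  obtain ⟨j, rfl⟩ := hq hc
  exact ha' j

/-! ### Integrality of the density -/

theorem VCIndDensityLE.natCast [Finite α] {n : ℕ} {ℓ : ℝ} (hℓ : ℓ < (n : ℝ) + 1)
    (H : VCIndDensityLE M p φ ℓ) : VCIndDensityLE M p φ (n : ℝ) := by
  obtain ⟨K, hK⟩ := H
  -- With `|K|` the bound is nonnegative, as needed for lengths `k > N`, where `P` has no words.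
  obtain ⟨K', hK'⟩ := exists_ncard_le_mul_pow |K| ℓ n hℓ
  refine ⟨K', fun N hN b hb => ?_⟩
  let P : Set (List Bool) := {w | ∃ h ∈ patterns p φ b, w.Sublist (List.ofFn h)}
  have hsub : ∀ (k : ℕ) (hk : k ≤ N) (w : List Bool), w ∈ P → w.length = k →
      -- The default `false` is never reached, since `w` has length `k`.
      (fun i : Fin k => w.getD i false) ∈ patterns p φ (b ∘ Fin.castLEOrderEmb hk) := by
    rintro k hk w ⟨h, hh, hw⟩ rfl
    obtain ⟨f, hf⟩ := List.sublist_iff_exists_fin_orderEmbedding_get_eq.1 hw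
    have hN' : (List.ofFn h).length = N := List.length_ofFn
    convert hb.comp_mem_patterns hh (f.trans (Fin.castOrderIso hN').toOrderEmbedding)
      (Fin.castLEOrderEmb hk) using 1
    funext i
    have := hf i
    simp only [List.get_eq_getElem, List.getElem_ofFn] at this
    simp only [List.getD_eq_getElem _ _ i.2, this]
    rfl
  have hP := hK' P (fun v w hvw ⟨h, hh, hw⟩ => ⟨h, hh, hvw.trans hw⟩) ?_ N hN
  · rw [Real.rpow_natCast]
    refine le_trans ?_ hP
    rw [← ncard_patterns, Nat.cast_le]
    exact Set.ncard_le_ncard_of_injOn List.ofFn (fun h hh => ⟨⟨h, hh, List.Sublist.refl _⟩,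
      List.length_ofFn⟩) List.ofFn_injective.injOn
      ((List.finite_length_eq Bool N).subset fun v hv => hv.2)
  · intro k hk
    rcases le_or_gt k N with hkN | hkN
    · refine le_trans ?_ ((hK k hk _ (hb.comp (Fin.castLEOrderEmb hkN))).trans ?_)
      · rw [← ncard_patterns, Nat.cast_le]
        refine Set.ncard_le_ncard_of_injOn (fun w (i : Fin k) => w.getD i false)
          (fun w hw => hsub k hkN w hw.1 hw.2) ?_ (Set.toFinite _)
        rintro v ⟨-, hv⟩ w ⟨-, hw⟩ e
        refine List.ext_getElem (hv.trans hw.symm) fun i h₁ h₂ => ?_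
        have := congrFun e ⟨i, hv ▸ h₁⟩
        simpa [h₁, h₂] using this
      · gcongr
        exact le_abs_self K
    · have : {w ∈ P | w.length = k} = ∅ := by
        refine Set.eq_empty_of_forall_notMem ?_
        rintro w ⟨⟨h, -, hw⟩, rfl⟩
        have := hw.length_le
        simp at this
        omega
      rw [this]
      simp only [Set.ncard_empty, Nat.cast_zero]
      positivity

theorem VCIndDensityLE.mono {ℓ ℓ' : ℝ} (h : ℓ ≤ ℓ') (H : VCIndDensityLE M p φ ℓ) :
    VCIndDensityLE M p φ ℓ' := by
  obtain ⟨K, hK⟩ := H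
  refine ⟨|K|, fun N hN b hb => (hK N hN b hb).trans ?_⟩
  have : (1 : ℝ) ≤ N := by exact_mod_cast hN
  gcongr
  exact le_abs_self K

/-- A constant sequence is indiscernible and carries at least one type, so the bound cannot tend to
`0` as `N` grows. -/
theorem VCIndDensityLE.nonneg [Nonempty M] (hp : IsPartialType M p) {ℓ : ℝ}
    (H : VCIndDensityLE M p φ ℓ) : 0 ≤ ℓ := by
  obtain ⟨K, hK⟩ := H
  by_contra! hℓ
  obtain ⟨c⟩ : Nonempty (β → M) := inferInstance
  have h0 : ConsistentWith p φ (∅ : Set ((β → M) × Bool)) := fun p₀ q₀ h1 h2 h3 _ => by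
    obtain ⟨a, ha⟩ := hp p₀ h1 h2
    exact ⟨a, ha, fun d hd => (h3 hd).elim⟩
  obtain ⟨s, hs⟩ := h0.exists_insert c
  have h1 : ∀ N : ℕ, 0 < N → 1 ≤ K * (N : ℝ) ^ ℓ := by
    intro N hN
    refine le_trans ?_ (hK N hN (fun _ => c) fun k θ f g => Iff.rfl)
    rw [← ncard_patterns, Nat.one_le_cast, Nat.one_le_iff_ne_zero, ← Nat.pos_iff_ne_zero,
      Set.ncard_pos]
    refine ⟨fun _ => s, hs.mono ?_⟩
    rintro _ ⟨i, rfl⟩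
    simp
  have h2 : Filter.Tendsto (fun N : ℕ => K * (N : ℝ) ^ ℓ) Filter.atTop (nhds (K * 0)) := by
    have := (tendsto_rpow_neg_atTop (neg_pos.2 hℓ)).comp tendsto_natCast_atTop_atTop
    simp only [neg_neg] at this
    exact this.const_mul K
  have h3 := ge_of_tendsto h2 ((Filter.eventually_gt_atTop 0).mono h1)
  norm_num at h3

theorem vcIndDensity_eq_top_or_natCast [Finite α] [Nonempty M] (hp : IsPartialType M p) :
    vcIndDensity M p φ = ⊤ ∨ ∃ n : ℕ, vcIndDensity M p φ = ((n : ℝ) : EReal) := by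
  classical
  by_cases H : ∃ n : ℕ, VCIndDensityLE M p φ (n : ℝ)
  · refine Or.inr ⟨Nat.find H, le_antisymm (sInf_le ⟨_, Nat.find_spec H, rfl⟩) (le_sInf ?_)⟩
    rintro _ ⟨ℓ, hℓ, rfl⟩
    refine EReal.coe_le_coe_iff.2 (not_lt.1 fun hlt => ?_)
    -- An exponent below the least integer one is negative if that integer is `0`; otherwise
    -- `natCast` rounds it to a smaller integer exponent.
    rcases hn : Nat.find H with _ | n
    · rw [hn, Nat.cast_zero] at hlt
      exact absurd (VCIndDensityLE.nonneg hp hℓ) (not_le.2 hlt)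
    · rw [hn, Nat.cast_succ] at hlt
      exact Nat.find_min H (by omega : n < Nat.find H) (VCIndDensityLE.natCast hlt hℓ)
  · left
    have : {ℓ : ℝ | VCIndDensityLE M p φ ℓ} = ∅ := by
      refine Set.eq_empty_of_forall_notMem fun ℓ hℓ => H ?_
      obtain ⟨n, hn⟩ := exists_nat_ge ℓ
      exact ⟨n, VCIndDensityLE.mono hn hℓ⟩
    simp [vcIndDensity, this]

end VCInd

/-- The VC_ind-density is integer valued. `M` is an arbitrary nonempty first-order structure, in
particular it can be a monster model of any complete theory. -/
theorem mainTheorem2 {L : FirstOrder.Language} (M : Type*) [L.Structure M] [Nonempty M]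
    {α β : Type*} [Finite α] [Finite β]
    (p : Set (L.Formula α)) (φ : L.Formula (α ⊕ β)) :
    (∀ (n : ℕ) (ℓ : ℝ), ℓ < (n : ℝ) + 1 →
      VCInd.VCIndDensityLE M p φ ℓ → VCInd.VCIndDensityLE M p φ (n : ℝ)) ∧
    (VCInd.IsPartialType M p →
      VCInd.vcIndDensity M p φ = ⊤ ∨
        ∃ n : ℕ, VCInd.vcIndDensity M p φ = ((n : ℝ) : EReal)) :=
  ⟨fun _ _ hℓ H => H.natCast hℓ, fun hp => VCInd.vcIndDensity_eq_top_or_natCast hp⟩
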